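/- Let $E$ be a real vector lattice, and let $\mathrm{Hom}(E)$ be the set of all (not necessarily continuous) linear lattice homomorphisms $E\to\mathbb{R}$. A set $A\subset E$ is called an AM-set if it is solid (that is, $g\in A$ and $|f|\le|g|$ imply $f\in A$) and $f\vee g\in A$ for all $f,g\in A$ with $f,g\ge 0$. A linear topology on $E$ is called an AM-topology if it has a base of neighbourhoods of $0$ consisting of AM-sets. A Hausdorff topology is called compactly generated if a set is open whenever its intersection with every compact set $K$ is open in $K$. Assume that $E$ is endowed with a Hausdorff compactly generated AM-topology, and let $E^{*}$ be the continuous dual of $E$. Let $F\subset E$ be a (linear) sublattice and let $F^{\bot}=\{\varphi\in E^{*}:\ \varphi(f)=0 \text{ for all } f\in F\}$. Then $$\overline{F}=\left(F^{\bot}\cap\left(\mathrm{Hom}(E)-\mathrm{Hom}(E)\right)\right)_{\bot},$$ that is, $\overline F$ is the set of all $e\in E$ such that $\varphi(e)=0$ for every $\varphi\in F^{\bot}$ of the form $\varphi=\mu-\nu$ with $\mu,\nu\in\mathrm{Hom}(E)$. In particular, $F$ is dense in $E$ if and only if it separates the points of $\mathrm{Hom}(E)\cap E^{*}$, that is, for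 any distinct $\mu,\nu\in\mathrm{Hom}(E)\cap E^{*}$ there is $f\in F$ such that $\mu(f)\ne\nu(f)$. -/

import Mathlib

open scoped Pointwise Topology

namespace VectorLattice

/-- An AM-set in a vector lattice: a solid set `A` such that `f ⊔ g ∈ A` whenever
`f, g ∈ A` are positive. -/
structure IsAMSet {E : Type*} [AddCommGroup E] [Lattice E] (A : Set E) : Prop where
  solid : LatticeOrderedAddCommGroup.IsSolid A
  sup_mem : ∀ f ∈ A, ∀ g ∈ A, 0 ≤ f → 0 ≤ g → f ⊔ g ∈ A

/-- A linear topology on a vector lattice is an AM-topology if it has a base of neighbourhoods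
of `0` which consists of AM-sets. -/
class IsAMTopology (E : Type*) [AddCommGroup E] [Lattice E] [IsOrderedAddMonoid E]
    [Module ℝ E] [IsOrderedModule ℝ E] [TopologicalSpace E] : Prop
    extends IsTopologicalAddGroup E, ContinuousSMul ℝ E where
  exists_isAMSet_subset : ∀ U ∈ 𝓝 (0 : E), ∃ A ∈ 𝓝 (0 : E), IsAMSet A ∧ A ⊆ U

/-- The set `Hom(E)` of all (not necessarily continuous) real-valued vector lattice
homomorphisms on `E`. -/
def latticeHoms (E : Type*) [AddCommGroup E] [Lattice E] [Module ℝ E] : Set (E →ₗ[ℝ] ℝ) :=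
  {φ | ∀ x y : E, φ (x ⊔ y) = φ x ⊔ φ y ∧ φ (x ⊓ y) = φ x ⊓ φ y}

/-- The annihilator of a set in the continuous dual. -/
def annihilator {E : Type*} [AddCommGroup E] [Module ℝ E] [TopologicalSpace E] (S : Set E) :
    Set (StrongDual ℝ E) :=
  {φ | ∀ x ∈ S, φ x = 0}

/-- The pre-annihilator of a set of continuous functionals. -/
def preannihilator {E : Type*} [AddCommGroup E] [Module ℝ E] [TopologicalSpace E]
    (Φ : Set (StrongDual ℝ E)) : Set E :=
  {x | ∀ φ ∈ Φ, φ x = 0}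

/-- The elements of the continuous dual whose underlying linear functional lies in `H`, that is,
the intersection of `H` with the continuous dual. -/
def continuousPart {E : Type*} [AddCommGroup E] [Module ℝ E] [TopologicalSpace E]
    (H : Set (E →ₗ[ℝ] ℝ)) : Set (StrongDual ℝ E) :=
  {φ | (φ : E →ₗ[ℝ] ℝ) ∈ H}

end VectorLattice

/-! For an AM-neighbourhood `A` of `0`, the functional `p x = gauge A (x ⊔ 0)` is sublinear and
preserves suprema. A Hahn-Banach argument (`exists_odd_le_eq`) shows that each value of `p` is
attained by a lattice homomorphism below `p`. These homomorphisms are continuous and form a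
pointwise compact set `K`, so `f - e ∈ A` follows once `f` approximates `e` uniformly on `K`. As in
the Kakutani-Stone theorem, it suffices to approximate at two points of `K`
(`exists_forall_abs_sub_lt`). There the image of `F` in the plane is a linear sublattice:
everything, or cut out by relations `a * μ = b * ν` with `a, b ≥ 0` (`exists_eq_and_eq`). Since `a •
μ` and `b • ν` are again continuous homomorphisms, `e` satisfies the same relations. -/

namespace VectorLattice

/-! ### Hahn-Banach for sup-preserving sublinear functionals -/

section Sublinear

variable {E : Type*} [AddCommGroup E] [Lattice E] [Module ℝ E]

/-- A sublinear functional which preserves binary suprema. -/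
structure IsSupSublinear (p : E → ℝ) : Prop where
  smul : ∀ c : ℝ, 0 < c → ∀ x, p (c • x) = c * p x
  add_le : ∀ x y, p (x + y) ≤ p x + p y
  sup : ∀ x y, p (x ⊔ y) = p x ⊔ p y

theorem isClosed_setOf_isSupSublinear : IsClosed {p : E → ℝ | IsSupSublinear p} := by
  have h : {p : E → ℝ | IsSupSublinear p} =
      (⋂ (c : ℝ) (_ : 0 < c) (x : E), {p : E → ℝ | p (c • x) = c * p x}) ∩
      ((⋂ (x : E) (y : E), {p : E → ℝ | p (x + y) ≤ p x + p y}) ∩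
      (⋂ (x : E) (y : E), {p : E → ℝ | p (x ⊔ y) = p x ⊔ p y})) := by
    ext p
    simp only [Set.mem_inter_iff, Set.mem_iInter]
    exact ⟨fun h => ⟨h.smul, h.add_le, h.sup⟩, fun h => ⟨h.1, h.2.1, h.2.2⟩⟩
  rw [h]
  refine IsClosed.inter ?_ (IsClosed.inter ?_ ?_)
  · exact isClosed_iInter fun c => isClosed_iInter fun _ => isClosed_iInter fun x =>
      isClosed_eq (by fun_prop) (by fun_prop)
  · exact isClosed_iInter fun x => isClosed_iInter fun y =>
      isClosed_le (by fun_prop) (by fun_prop)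
  · exact isClosed_iInter fun x => isClosed_iInter fun y =>
      isClosed_eq (by fun_prop) (by fun_prop)

namespace IsSupSublinear

variable {p : E → ℝ}

theorem map_zero (hp : IsSupSublinear p) : p 0 = 0 := by
  have := hp.smul 2 two_pos 0
  rw [smul_zero] at this
  linarith

theorem neg_le (hp : IsSupSublinear p) (x : E) : -p (-x) ≤ p x := by
  have := hp.add_le x (-x)
  rw [add_neg_cancel, hp.map_zero] at this
  linarith

theorem smul_nonneg (hp : IsSupSublinear p) {c : ℝ} (hc : 0 ≤ c) (x : E) :
    p (c • x) = c * p x := by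
  rcases hc.eq_or_lt with rfl | hc
  · simp [hp.map_zero]
  · exact hp.smul c hc x

theorem antitone_shift (hp : IsSupSublinear p) (g x : E) :
    Antitone fun t : ℝ => p (x + t • g) - t * p g := by
  intro t s hts
  have h := hp.add_le (x + t • g) ((s - t) • g)
  rw [hp.smul_nonneg (sub_nonneg.2 hts), add_assoc, ← add_smul, add_sub_cancel] at h
  dsimp only
  linarith

theorem bddBelow_shift (hp : IsSupSublinear p) (g x : E) :
    BddBelow (Set.range fun t : ℝ => p (x + t • g) - t * p g) := by
  refine ⟨-p (-x), ?_⟩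
  rintro _ ⟨t, rfl⟩
  refine le_trans ?_ (hp.antitone_shift g x (le_max_left t 0))
  have h := hp.add_le (x + max t 0 • g) (-x)
  rw [add_neg_cancel_comm, hp.smul_nonneg (le_max_right t 0)] at h
  dsimp only
  linarith

/-- A sup-preserving sublinear functional has a sup-preserving sublinear minorant which is at most
`-p g` at `-g`. -/
theorem exists_le_neg [IsOrderedAddMonoid E] (hp : IsSupSublinear p) (g : E) :
    ∃ q : E → ℝ, IsSupSublinear q ∧ q ≤ p ∧ q (-g) ≤ -p g := by
  -- By monotonicity this infimum is a limit as `t → ∞`, so each axiom passes from `p` to `q`;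
  -- rescaling `t` is harmless in the limit.
  set q : E → ℝ := fun x => ⨅ t : ℝ, (p (x + t • g) - t * p g) with hq
  have hlim (x : E) : Filter.Tendsto (fun t : ℝ => p (x + t • g) - t * p g) Filter.atTop
      (𝓝 (q x)) := tendsto_atTop_ciInf (hp.antitone_shift g x) (hp.bddBelow_shift g x)
  have hle (x : E) (t : ℝ) : q x ≤ p (x + t • g) - t * p g := ciInf_le (hp.bddBelow_shift g x) t
  refine ⟨q, ⟨fun c hc x => ?_, fun x y => ?_, fun x y => ?_⟩, fun x => ?_, ?_⟩
  · refine tendsto_nhds_unique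
      ((hlim (c • x)).comp (Filter.tendsto_id.const_mul_atTop hc)) (((hlim x).const_mul c).congr ?_)
    intro t
    simp only [Function.comp, id, mul_smul, ← smul_add, hp.smul c hc]
    ring
  · refine le_of_tendsto_of_tendsto'
      ((hlim (x + y)).comp (Filter.tendsto_id.const_mul_atTop two_pos))
      ((hlim x).add (hlim y)) fun t => ?_
    have h := hp.add_le (x + t • g) (y + t • g)
    rw [add_add_add_comm, ← two_smul ℝ (t • g), smul_smul] at h
    simp only [Function.comp, id]
    linarith
  · refine tendsto_nhds_unique (hlim (x ⊔ y)) (((hlim x).sup_nhds (hlim y)).congr ?_)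
    intro t
    rw [sup_add, hp.sup]
    exact max_sub_sub_right _ _ _
  · simpa using hle x 0
  · simpa [hp.map_zero] using hle (-g) 1

/-- A sup-preserving sublinear functional dominates a minimal one. -/
theorem exists_minimal_le (hp : IsSupSublinear p) :
    ∃ q ≤ p, Minimal (fun q : E → ℝ => IsSupSublinear q) q := by
  -- The infimum of a chain is a pointwise limit along it, and the axioms are closed conditions.
  refine zorn_le_nonempty₀ (α := (E → ℝ)ᵒᵈ) {q | IsSupSublinear (E := E) q} ?_ p hp
  intro c hc hchain q₀ hq₀
  have hne : Nonempty c := ⟨⟨q₀, hq₀⟩⟩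
  have hdir : IsDirectedOrder c := ⟨hchain.directedOn.directed_val⟩
  have hbdd (x : E) : BddBelow (Set.range fun q : c => (q.1 : E → ℝ) x) := by
    refine ⟨-q₀ (-x), ?_⟩
    rintro _ ⟨q, rfl⟩
    obtain ⟨r, hqr, h0r⟩ := hdir.directed q ⟨q₀, hq₀⟩
    exact (neg_le_neg (h0r (-x))).trans (((hc r.2).neg_le x).trans (hqr x))
  refine ⟨fun x => ⨅ q : c, (q.1 : E → ℝ) x, ?_, fun q hq x => ciInf_le (hbdd x) ⟨q, hq⟩⟩
  refine isClosed_setOf_isSupSublinear.mem_of_tendsto (f := fun q : c => (q.1 : E → ℝ))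
    (b := Filter.atTop) ?_ (Filter.Eventually.of_forall fun q => hc q.2)
  exact tendsto_pi_nhds.2 fun x => tendsto_atTop_ciInf (fun q r h => h x) (hbdd x)

/-- Minimality leaves no room below `p`, so the minorant from `exists_le_neg` forces `p (-x) ≤ -p
x`. -/
theorem map_neg_of_minimal [IsOrderedAddMonoid E]
    (hp : Minimal (fun q : E → ℝ => IsSupSublinear q) p) (x : E) : p (-x) = -p x := by
  obtain ⟨q, hq, hqp, hqx⟩ := hp.prop.exists_le_neg x
  have h := hp.le_of_le hq hqp (-x)
  have := hp.prop.neg_le x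
  linarith

/-- An odd sup-preserving sublinear functional is a lattice homomorphism. -/
theorem exists_latticeHom [IsOrderedAddMonoid E] (hp : IsSupSublinear p)
    (hneg : ∀ x, p (-x) = -p x) : ∃ φ ∈ latticeHoms E, ⇑φ = p := by
  have hadd (x y : E) : p (x + y) = p x + p y := by
    refine le_antisymm (hp.add_le x y) ?_
    have h := hp.add_le (-x) (-y)
    rw [← neg_add, hneg, hneg, hneg] at h
    linarith
  have hsmul (c : ℝ) (x : E) : p (c • x) = c * p x := by
    rcases le_total 0 c with hc | hc
    · exact hp.smul_nonneg hc x
    · have h := hp.smul_nonneg (neg_nonneg.2 hc) x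
      rw [neg_smul, hneg] at h
      linarith
  refine ⟨{ toFun := p, map_add' := hadd, map_smul' := hsmul }, fun x y => ⟨hp.sup x y, ?_⟩, rfl⟩
  change p (x ⊓ y) = p x ⊓ p y
  rw [← neg_neg (x ⊓ y), neg_inf, hneg, hp.sup, hneg, hneg, ← neg_inf, neg_neg]

/-- A Hahn-Banach theorem for lattice homomorphisms. -/
theorem exists_odd_le_eq [IsOrderedAddMonoid E] (hp : IsSupSublinear p) (e : E) :
    ∃ q : E → ℝ, IsSupSublinear q ∧ (∀ x, q (-x) = -q x) ∧ q ≤ p ∧ q e = p e := by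
  -- Bounding the value at `-e` before minimizing makes the odd functional below `r` at least `p e`
  -- at `e`.
  obtain ⟨r, hr, hrp, hre⟩ := hp.exists_le_neg e
  obtain ⟨q, hqr, hq⟩ := hr.exists_minimal_le
  refine ⟨q, hq.prop, map_neg_of_minimal hq, hqr.trans hrp, ?_⟩
  refine le_antisymm (hqr.trans hrp e) ?_
  have := hqr (-e)
  rw [map_neg_of_minimal hq] at this
  linarith

/-- Tychonoff: oddness confines `q x` to `[-p (-x), p x]`. -/
theorem isCompact_setOf_odd_le (p : E → ℝ) :
    IsCompact {q : E → ℝ | IsSupSublinear q ∧ (∀ x, q (-x) = -q x) ∧ q ≤ p} := by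
  have hc : IsClosed {q : E → ℝ | IsSupSublinear q ∧ (∀ x, q (-x) = -q x) ∧ q ≤ p} := by
    refine isClosed_setOf_isSupSublinear.inter (IsClosed.inter ?_ isClosed_Iic)
    have h : {q : E → ℝ | ∀ x, q (-x) = -q x} = ⋂ x : E, {q : E → ℝ | q (-x) = -q x} := by
      ext q
      simp only [Set.mem_iInter]
      exact Iff.rfl
    change IsClosed {q : E → ℝ | ∀ x, q (-x) = -q x}
    rw [h]
    exact isClosed_iInter fun x => isClosed_eq (by fun_prop) (by fun_prop)
  refine (isCompact_univ_pi fun x : E => isCompact_Icc (a := -p (-x)) (b := p x)).of_isClosed_subset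
    hc ?_
  rintro q ⟨-, hneg, hle⟩ x -
  refine ⟨?_, hle x⟩
  have := hle (-x)
  rw [hneg] at this
  linarith

end IsSupSublinear

end Sublinear

/-! ### Kakutani-Stone approximation -/

section Approximation

variable {E : Type*} [Lattice E]

/-- Two-point approximation on a compact set of lattice homomorphisms gives uniform
approximation. -/
theorem exists_forall_abs_sub_lt {K : Set (E → ℝ)} (hK : IsCompact K) (hne : K.Nonempty)
    (hsup : ∀ k ∈ K, ∀ x y, k (x ⊔ y) = k x ⊔ k y) (hinf : ∀ k ∈ K, ∀ x y, k (x ⊓ y) = k x ⊓ k y)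
    {F : Set E} (hF : IsSublattice F) (e : E) {ε : ℝ}
    (h : ∀ k ∈ K, ∀ l ∈ K, ∃ f ∈ F, |k f - k e| < ε ∧ |l f - l e| < ε) :
    ∃ f ∈ F, ∀ k ∈ K, |k f - k e| < ε := by
  have hupper : ∀ k ∈ K, ∃ f ∈ F, k e - ε < k f ∧ ∀ l ∈ K, l f < l e + ε := by
    intro k hk
    -- Compactness induction ranges over arbitrary sets, hence the repeated `l ∈ K`. Finite infima
    -- give the upper bound; finite suprema later give the lower one.
    suffices H : ∃ f ∈ F, k e - ε < k f ∧ ∀ l ∈ K, l ∈ K → l f < l e + ε by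
      obtain ⟨f, hf, hkf, hfK⟩ := H
      exact ⟨f, hf, hkf, fun l hl => hfK l hl hl⟩
    refine hK.induction_on (p := fun S => ∃ f ∈ F, k e - ε < k f ∧ ∀ l ∈ S, l ∈ K → l f < l e + ε)
      ?_ ?_ ?_ ?_
    · obtain ⟨f, hf, hkf, -⟩ := h k hk k hk
      exact ⟨f, hf, by linarith [(abs_lt.1 hkf).1], by simp⟩
    · rintro S T hST ⟨f, hf, hkf, hfT⟩
      exact ⟨f, hf, hkf, fun l hl => hfT l (hST hl)⟩
    · rintro S T ⟨f, hf, hkf, hfS⟩ ⟨g, hg, hkg, hgT⟩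
      refine ⟨f ⊓ g, hF.infClosed hf hg, ?_, fun l hl hlK => ?_⟩
      · rw [hinf k hk]
        exact lt_min hkf hkg
      · rw [hinf l hlK]
        exact hl.elim (fun hl => min_lt_of_left_lt (hfS l hl hlK))
          (fun hl => min_lt_of_right_lt (hgT l hl hlK))
    · intro l hl
      obtain ⟨f, hf, hkf, hlf⟩ := h k hk l hl
      refine ⟨{m : E → ℝ | m f < m e + ε}, mem_nhdsWithin_of_mem_nhds ?_, f, hf,
        by linarith [(abs_lt.1 hkf).1], fun m hm _ => hm⟩
      refine (isOpen_lt (by fun_prop) (by fun_prop)).mem_nhds ?_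
      change l f < l e + ε
      linarith [(abs_lt.1 hlf).2]
  suffices H : ∃ f ∈ F, (∀ l ∈ K, l f < l e + ε) ∧ ∀ k ∈ K, k ∈ K → k e - ε < k f by
    obtain ⟨f, hf, hu, hl⟩ := H
    exact ⟨f, hf, fun k hk => abs_lt.2 ⟨by linarith [hl k hk hk], by linarith [hu k hk]⟩⟩
  refine hK.induction_on
    (p := fun S => ∃ f ∈ F, (∀ l ∈ K, l f < l e + ε) ∧ ∀ k ∈ S, k ∈ K → k e - ε < k f)
    ?_ ?_ ?_ ?_
  · obtain ⟨k, hk⟩ := hne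
    obtain ⟨f, hf, -, hfK⟩ := hupper k hk
    exact ⟨f, hf, hfK, by simp⟩
  · rintro S T hST ⟨f, hf, hfK, hfT⟩
    exact ⟨f, hf, hfK, fun l hl => hfT l (hST hl)⟩
  · rintro S T ⟨f, hf, hfK, hfS⟩ ⟨g, hg, hgK, hgT⟩
    refine ⟨f ⊔ g, hF.supClosed hf hg, fun l hl => ?_, fun k hk hkK => ?_⟩
    · rw [hsup l hl]
      exact max_lt (hfK l hl) (hgK l hl)
    · rw [hsup k hkK]
      exact hk.elim (fun hk => lt_max_of_lt_left (hfS k hk hkK))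
        (fun hk => lt_max_of_lt_right (hgT k hk hkK))
  · intro k hk
    obtain ⟨f, hf, hkf, hfK⟩ := hupper k hk
    refine ⟨{m : E → ℝ | m e - ε < m f}, mem_nhdsWithin_of_mem_nhds ?_, f, hf, hfK,
      fun m hm _ => hm⟩
    exact (isOpen_lt (by fun_prop) (by fun_prop)).mem_nhds hkf

end Approximation

/-! ### Pairs of lattice homomorphisms -/

section LatticeHoms

variable {E : Type*} [AddCommGroup E] [Lattice E] [Module ℝ E]

theorem map_abs_of_mem_latticeHoms {μ : E →ₗ[ℝ] ℝ} (hμ : μ ∈ latticeHoms E) (x : E) :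
    μ |x| = |μ x| := by
  rw [abs, (hμ x (-x)).1, map_neg]
  rfl

theorem smul_mem_latticeHoms {μ : E →ₗ[ℝ] ℝ} (hμ : μ ∈ latticeHoms E) {c : ℝ} (hc : 0 ≤ c) :
    c • μ ∈ latticeHoms E := by
  intro x y
  simp only [LinearMap.smul_apply, smul_eq_mul, (hμ x y).1, (hμ x y).2]
  exact ⟨mul_max_of_nonneg _ _ hc, mul_min_of_nonneg _ _ hc⟩

/-- If a vector `e` satisfies all linear relations with nonnegative coefficients that hold between
two lattice homomorphisms on a sublattice, then the two homomorphisms take the same values at `e`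
and at some vector of the sublattice. -/
theorem exists_eq_and_eq {μ ν : E →ₗ[ℝ] ℝ} (hμ : μ ∈ latticeHoms E) (hν : ν ∈ latticeHoms E)
    {F : Submodule ℝ E} (hF : IsSublattice (F : Set E)) {e : E}
    (h : ∀ a b : ℝ, 0 ≤ a → 0 ≤ b → (∀ f ∈ F, a * μ f = b * ν f) → a * μ e = b * ν e) :
    ∃ f ∈ F, μ f = μ e ∧ ν f = ν e := by
  by_cases hμF : ∀ f ∈ F, μ f = 0
  · have hμe : μ e = 0 := by simpa using h 1 0 zero_le_one le_rfl (by simpa using hμF)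
    by_cases hνF : ∀ f ∈ F, ν f = 0
    · have hνe : ν e = 0 := by
        simpa using (h 0 1 le_rfl zero_le_one (by simpa [eq_comm] using hνF)).symm
      exact ⟨0, F.zero_mem, by simp [hμe], by simp [hνe]⟩
    · push Not at hνF
      obtain ⟨f, hf, hf0⟩ := hνF
      refine ⟨(ν e / ν f) • f, F.smul_mem _ hf, ?_, ?_⟩
      · simp [hμF f hf, hμe]
      · simp [hf0]
  · push Not at hμF
    obtain ⟨f, hf, hf0⟩ := hμF
    -- Passing to `|f|` makes both coefficients of the candidate relation nonnegative.
    have hg : |f| ∈ F := hF.supClosed hf (F.neg_mem hf)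
    have hg0 : 0 < μ |f| := by simpa [map_abs_of_mem_latticeHoms hμ] using hf0
    have hνg : 0 ≤ ν |f| := by simp [map_abs_of_mem_latticeHoms hν]
    by_cases hrel : ∀ f' ∈ F, ν |f| * μ f' = μ |f| * ν f'
    · have he := h _ _ hνg hg0.le hrel
      refine ⟨(μ e / μ |f|) • |f|, F.smul_mem _ hg, ?_, ?_⟩
      · simp [hg0.ne']
      · rw [map_smul, smul_eq_mul]
        field_simp
        linarith
    · push Not at hrel
      obtain ⟨f', hf', hne⟩ := hrel
      have hd : μ |f| * ν f' - ν |f| * μ f' ≠ 0 := sub_ne_zero.2 hne.symm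
      -- Cramer's rule for the values at `|f|` and `f'`.
      refine ⟨((μ e * ν f' - ν e * μ f') / (μ |f| * ν f' - ν |f| * μ f')) • |f| +
        ((μ |f| * ν e - ν |f| * μ e) / (μ |f| * ν f' - ν |f| * μ f')) • f',
        F.add_mem (F.smul_mem _ hg) (F.smul_mem _ hf'), ?_, ?_⟩
      · rw [map_add, map_smul, map_smul, smul_eq_mul, smul_eq_mul, div_mul_eq_mul_div,
          div_mul_eq_mul_div, ← add_div, div_eq_iff hd]
        ring
      · rw [map_add, map_smul, map_smul, smul_eq_mul, smul_eq_mul, div_mul_eq_mul_div,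
          div_mul_eq_mul_div, ← add_div, div_eq_iff hd]
        ring

end LatticeHoms

/-! ### Gauges of AM-sets -/

section AMSet

variable {E : Type*} [AddCommGroup E] [Lattice E]

theorem smul_sup_of_pos [Module ℝ E] [IsOrderedModule ℝ E] {c : ℝ} (hc : 0 < c) (x y : E) : c • (x ⊔ y) = c • x ⊔ c • y :=
  (OrderIso.smulRight hc).map_sup x y

namespace IsAMSet

variable {A : Set E} [IsOrderedAddMonoid E]

theorem mem_of_le (hA : IsAMSet A) {x y : E} (hx : x ∈ A) (hy : 0 ≤ y) (hyx : y ≤ x) : y ∈ A :=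
  hA.solid hx (by rwa [abs_of_nonneg hy, abs_of_nonneg (hy.trans hyx)])

theorem abs_mem_iff (hA : IsAMSet A) {x : E} : |x| ∈ A ↔ x ∈ A :=
  ⟨fun h => hA.solid h (by rw [abs_abs]), fun h => hA.solid h (by rw [abs_abs])⟩

variable [Module ℝ E] [IsOrderedModule ℝ E]

/-- A convex combination is dominated in absolute value by `|x| ⊔ |y|`, which lies in `A`. -/
theorem convex (hA : IsAMSet A) : Convex ℝ A := by
  intro x hx y hy a b ha hb hab
  have hs : |x| ⊔ |y| ∈ A := hA.sup_mem _ (hA.abs_mem_iff.2 hx) _ (hA.abs_mem_iff.2 hy)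
    (abs_nonneg x) (abs_nonneg y)
  refine hA.solid hs ?_
  rw [abs_of_nonneg (le_sup_of_le_left (abs_nonneg x))]
  have hle {c : ℝ} (hc : 0 ≤ c) {z : E} (hz : |z| ≤ |x| ⊔ |y|) :
      |c • z| ≤ c • (|x| ⊔ |y|) := by
    refine abs_le'.2 ⟨smul_le_smul_of_nonneg_left ((le_abs_self z).trans hz) hc, ?_⟩
    rw [← smul_neg]
    exact smul_le_smul_of_nonneg_left ((neg_le_abs z).trans hz) hc
  calc |a • x + b • y| ≤ |a • x| + |b • y| := abs_add_le _ _
    _ ≤ a • (|x| ⊔ |y|) + b • (|x| ⊔ |y|) := add_le_add (hle ha le_sup_left) (hle hb le_sup_right)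
    _ = |x| ⊔ |y| := by rw [← add_smul, hab, one_smul]

theorem gauge_mono (hA : IsAMSet A) (ha : Absorbent ℝ A) {x y : E} (hx : 0 ≤ x) (hxy : x ≤ y) :
    gauge A x ≤ gauge A y := by
  refine le_of_forall_gt_imp_ge_of_dense fun r hr => ?_
  obtain ⟨b, hb, hbr, hyb⟩ := exists_lt_of_gauge_lt ha hr
  refine (gauge_le_of_mem hb.le ?_).trans hbr.le
  rw [Set.mem_smul_set_iff_inv_smul_mem₀ hb.ne'] at hyb ⊢
  exact hA.mem_of_le hyb (smul_nonneg (inv_nonneg.2 hb.le) hx)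
    (smul_le_smul_of_nonneg_left hxy (inv_nonneg.2 hb.le))

theorem gauge_sup (hA : IsAMSet A) (ha : Absorbent ℝ A) {x y : E} (hx : 0 ≤ x) (hy : 0 ≤ y) :
    gauge A (x ⊔ y) = gauge A x ⊔ gauge A y := by
  refine le_antisymm ?_ (sup_le (hA.gauge_mono ha hx le_sup_left) (hA.gauge_mono ha hy le_sup_right))
  refine le_of_forall_gt_imp_ge_of_dense fun r hr => ?_
  have hmem {z : E} (hz : 0 ≤ z) (hzr : gauge A z < r) : r⁻¹ • z ∈ A := by
    obtain ⟨b, hb, hbr, hzb⟩ := exists_lt_of_gauge_lt ha hzr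
    rw [Set.mem_smul_set_iff_inv_smul_mem₀ hb.ne'] at hzb
    exact hA.mem_of_le hzb (smul_nonneg (inv_nonneg.2 (hb.trans hbr).le) hz)
      (smul_le_smul_of_nonneg_right (inv_anti₀ hb hbr.le) hz)
  have hr0 : 0 < r := (gauge_nonneg x).trans_lt ((le_max_left _ _).trans_lt hr)
  refine gauge_le_of_mem hr0.le ?_
  rw [Set.mem_smul_set_iff_inv_smul_mem₀ hr0.ne', smul_sup_of_pos (inv_pos.2 hr0)]
  exact hA.sup_mem _ (hmem hx ((le_max_left _ _).trans_lt hr))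
    _ (hmem hy ((le_max_right _ _).trans_lt hr)) (smul_nonneg (inv_nonneg.2 hr0.le) hx)
    (smul_nonneg (inv_nonneg.2 hr0.le) hy)

theorem isSupSublinear_gauge (hA : IsAMSet A) (ha : Absorbent ℝ A) :
    IsSupSublinear fun x => gauge A (x ⊔ 0) := by
  refine ⟨fun c hc x => ?_, fun x y => ?_, fun x y => ?_⟩
  · rw [← smul_eq_mul, ← gauge_smul_of_nonneg hc.le, smul_sup_of_pos hc, smul_zero]
  · refine le_trans (hA.gauge_mono ha le_sup_right ?_) (gauge_add_le hA.convex ha _ _)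
    exact sup_le (add_le_add le_sup_left le_sup_left) (add_nonneg le_sup_right le_sup_right)
  · rw [sup_sup_distrib_right, hA.gauge_sup ha le_sup_right le_sup_right]

theorem gauge_abs_lt_one_imp_mem (hA : IsAMSet A) (ha : Absorbent ℝ A) {x : E}
    (hx : gauge A |x| < 1) : x ∈ A := by
  obtain ⟨b, -, -, y, hy, -⟩ := exists_lt_of_gauge_lt ha hx
  have h0 : (0 : E) ∈ A := hA.solid hy (by simp)
  exact hA.abs_mem_iff.1 (setOfPred_gauge_lt_one_subset_self hA.convex h0 ha hx)

end IsAMSet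

end AMSet

/-! ### Continuity of dominated functionals -/

section Topology

variable {E : Type*} [AddCommGroup E] [Lattice E] [IsOrderedAddMonoid E] [Module ℝ E]
  [TopologicalSpace E] [IsTopologicalAddGroup E] [ContinuousSMul ℝ E]

/-- A linear functional dominated by the gauge of the positive part with respect to an AM-set which
is a neighbourhood of zero is continuous. -/
theorem continuous_of_le_gauge {A : Set E} (hA : IsAMSet A) (hA0 : A ∈ 𝓝 (0 : E))
    (φ : E →ₗ[ℝ] ℝ) (hφ : ∀ x, φ x ≤ gauge A (x ⊔ 0)) : Continuous φ := by
  have ha : Absorbent ℝ A := absorbent_nhds_zero hA0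
  have hle {x : E} (hx : x ∈ A) : φ x ≤ 1 := by
    refine (hφ x).trans (gauge_le_one_of_mem (hA.mem_of_le (hA.abs_mem_iff.2 hx) le_sup_right ?_))
    exact sup_le (le_abs_self x) (abs_nonneg x)
  have hbound (x : E) : |φ x| ≤ gauge A x := by
    refine le_of_forall_gt_imp_ge_of_dense fun r hr => ?_
    obtain ⟨b, hb, hbr, hxb⟩ := exists_lt_of_gauge_lt ha hr
    rw [Set.mem_smul_set_iff_inv_smul_mem₀ hb.ne'] at hxb
    have h1 := hle hxb
    have h2 := hle (hA.solid hxb (by rw [abs_neg]) : -(b⁻¹ • x) ∈ A)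
    rw [map_neg, map_smul, smul_eq_mul] at h2
    rw [map_smul, smul_eq_mul, inv_mul_le_iff₀ hb] at h1
    rw [← mul_neg, inv_mul_le_iff₀ hb] at h2
    exact abs_le'.2 ⟨by linarith, by linarith⟩
  refine continuous_of_continuousAt_zero φ ?_
  rw [ContinuousAt, map_zero]
  exact squeeze_zero_norm hbound (tendsto_gauge_nhds_zero hA0)

end Topology

/-! ### The closure of a sublattice -/

section Closure

variable {E : Type*} [AddCommGroup E] [Lattice E] [IsOrderedAddMonoid E] [Module ℝ E]
  [IsOrderedModule ℝ E] [TopologicalSpace E] [IsAMTopology E]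

/-- A vector lies in the closure of a linear sublattice if it satisfies all linear relations with
nonnegative coefficients which hold on the sublattice between two continuous lattice
homomorphisms. -/
theorem mem_closure_of_forall_latticeHoms {F : Submodule ℝ E} (hF : IsSublattice (F : Set E))
    {e : E}
    (h : ∀ μ ∈ continuousPart (latticeHoms E), ∀ ν ∈ continuousPart (latticeHoms E),
      (∀ f ∈ F, μ f = ν f) → μ e = ν e) :
    e ∈ closure (F : Set E) := by
  rw [mem_closure_iff_nhds_zero]
  intro U hU
  obtain ⟨A, hA0, hA, hAU⟩ := IsAMTopology.exists_isAMSet_subset U hU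
  have ha : Absorbent ℝ A := absorbent_nhds_zero hA0
  set p : E → ℝ := fun x => gauge A (x ⊔ 0) with hp_def
  have hp : IsSupSublinear p := hA.isSupSublinear_gauge ha
  set K : Set (E → ℝ) := {q | IsSupSublinear q ∧ (∀ x, q (-x) = -q x) ∧ q ≤ p}
  have hom {q : E → ℝ} (hq : q ∈ K) : ∃ φ : StrongDual ℝ E,
      φ ∈ continuousPart (latticeHoms E) ∧ ⇑φ = q := by
    obtain ⟨φ, hφ, rfl⟩ := hq.1.exists_latticeHom hq.2.1
    exact ⟨⟨φ, continuous_of_le_gauge hA hA0 φ hq.2.2⟩, hφ, rfl⟩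
  have hsmul {φ : StrongDual ℝ E} (hφ : φ ∈ continuousPart (latticeHoms E)) {c : ℝ} (hc : 0 ≤ c) :
      c • φ ∈ continuousPart (latticeHoms E) := smul_mem_latticeHoms hφ hc
  obtain ⟨q₀, h1, h2, h3, -⟩ := hp.exists_odd_le_eq 0
  obtain ⟨f, hf, hfK⟩ : ∃ f ∈ (F : Set E), ∀ k ∈ K, |k f - k e| < 1 := by
    refine exists_forall_abs_sub_lt (IsSupSublinear.isCompact_setOf_odd_le p) ⟨q₀, h1, h2, h3⟩
      (fun k hk => hk.1.sup) (fun k hk x y => ?_) hF e fun k hk l hl => ?_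
    · obtain ⟨φ, hφ, rfl⟩ := hom hk
      exact (hφ x y).2
    · obtain ⟨φ, hφ, rfl⟩ := hom hk
      obtain ⟨ψ, hψ, rfl⟩ := hom hl
      obtain ⟨f, hf, hφf, hψf⟩ := exists_eq_and_eq hφ hψ hF (e := e)
        fun a b ha hb hab => h (a • φ) (hsmul hφ ha) (b • ψ) (hsmul hψ hb) hab
      refine ⟨f, hf, ?_, ?_⟩
      · rw [show φ f = φ e from hφf, sub_self, abs_zero]
        exact one_pos
      · rw [show ψ f = ψ e from hψf, sub_self, abs_zero]
        exact one_pos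
  refine ⟨f, hf, hAU (hA.gauge_abs_lt_one_imp_mem ha ?_)⟩
  -- A homomorphism in `K` attaining `p` at `|f - e|` turns the uniform bound into a gauge bound.
  obtain ⟨q, hq, hneg, hqp, hqe⟩ := hp.exists_odd_le_eq |f - e|
  obtain ⟨φ, hφ, rfl⟩ := hom ⟨hq, hneg, hqp⟩
  have hlt := hfK φ ⟨hq, hneg, hqp⟩
  rw [← map_sub, ← show φ |f - e| = |φ (f - e)| from map_abs_of_mem_latticeHoms hφ _, hqe] at hlt
  simpa [hp_def, sup_of_le_left (abs_nonneg (f - e))] using hlt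

end Closure

end VectorLattice

theorem mainTheorem11 {E : Type*} [AddCommGroup E] [Lattice E] [IsOrderedAddMonoid E]
    [Module ℝ E] [IsOrderedModule ℝ E] [TopologicalSpace E] [VectorLattice.IsAMTopology E]
    [T2Space E] [CompactlyCoherentSpace E]
    (F : Submodule ℝ E) (hF : IsSublattice (F : Set E)) :
    closure (F : Set E) =
        VectorLattice.preannihilator
          (VectorLattice.annihilator (F : Set E) ∩
            VectorLattice.continuousPart
              (VectorLattice.latticeHoms E - VectorLattice.latticeHoms E)) ∧
      (Dense (F : Set E) ↔
        ∀ μ ∈ VectorLattice.continuousPart (VectorLattice.latticeHoms E),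
          ∀ ν ∈ VectorLattice.continuousPart (VectorLattice.latticeHoms E),
            μ ≠ ν → ∃ f ∈ F, μ f ≠ ν f) := by
  have hsep {e : E} (h : ∀ μ ∈ VectorLattice.continuousPart (VectorLattice.latticeHoms E),
      ∀ ν ∈ VectorLattice.continuousPart (VectorLattice.latticeHoms E),
      (∀ f ∈ F, μ f = ν f) → μ e = ν e) : e ∈ closure (F : Set E) :=
    VectorLattice.mem_closure_of_forall_latticeHoms hF h
  refine ⟨Set.Subset.antisymm ?_ fun e he => ?_, fun hd μ _ ν _ hne => ?_, fun h e => ?_⟩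
  · rintro e he φ ⟨hφ, -⟩
    exact closure_minimal (t := {x | φ x = 0}) hφ (isClosed_eq φ.continuous continuous_const) he
  · refine hsep fun μ hμ ν hν hμν => sub_eq_zero.1 (he (μ - ν) ⟨fun f hf => ?_, ?_⟩)
    · exact sub_eq_zero.2 (hμν f hf)
    · exact ⟨μ, hμ, ν, hν, rfl⟩
  · by_contra! hμν
    exact hne (DFunLike.coe_injective (Continuous.ext_on hd μ.continuous ν.continuous hμν))
  · refine hsep fun μ hμ ν hν hμν => ?_
    by_contra hne
    obtain ⟨f, hf, hfne⟩ := h μ hμ ν hν fun heq => hne (by rw [heq])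
    exact hfne (hμν f hf)
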